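/- Let $X$ be a Cantor space, that is, a non-empty compact metric space which is totally disconnected and has no isolated points, and let $\Gamma$ be a discrete group containing a finitely generated nilpotent subgroup of finite index. Let $\Phi\colon \Gamma\to \mathrm{Homeo}(X)$ be a minimal (every orbit is dense) and equicontinuous action. A non-empty clopen set $U\subset X$ is called *adapted* if for every $g\in\Gamma$, $\Phi(g)U\cap U\neq\emptyset$ implies $\Phi(g)U=U$; then $\Gamma_U=\{g\in\Gamma \mid \Phi(g)U\cap U\ne\emptyset\}$ is a subgroup of finite index. An *adapted neighborhood basis* at $x\in X$ is a sequence $U_1\supsetneq U_2\supsetneq\cdots$ of adapted sets with $\bigcap_\ell U_\ell=\{x\}$; such sequences exist. The *Steinitz order* of the action is the supernatural number $\xi=\mathrm{lcm}\{[\Gamma:\Gamma_{U_\ell}] \mid \ell\geq 1\}=\prod_p p^{\chi_\xi(p)}$ (which does not depend on the choice of $x$ and $(U_\ell)$), and its *type* is its class under the relation $\xi\sim\xi'$, meaning $m\xi=m'\xi'$ for some integers $m,m'\geq 1$. The *prime spectrum* of a Steinitz number $\xi'$ is $\pi(\xi')=\{p \text{ prime}\mid \chi_{\xi'}(p)>0\}$.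 The action has *finite prime spectrum* if $\pi(\xi')$ is finite for some $\xi'$ in its type (equivalently, if $\pi(\xi)$ is finite). Let $\mathfrak{G}(\Phi)=\overline{\Phi(\Gamma)}\subset\mathrm{Homeo}(X)$ be the closure in the topology of uniform convergence. **Theorem.** If the action $(X,\Gamma,\Phi)$ has finite prime spectrum, then it is stable. That is, the action of $\mathfrak{G}(\Phi)$ on $X$ is locally quasi-analytic: there is $\varepsilon>0$ such that for every non-empty open $U\subset X$ with $\mathrm{diam}(U)<\varepsilon$, every non-empty open $V\subset U$ and all $g_1,g_2\in\mathfrak{G}(\Phi)$, if $g_1|_V=g_2|_V$ then $g_1|_U=g_2|_U$. -/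

import Mathlib

namespace CantorAction

/-! ### Actions by homeomorphisms

An action of a discrete group `Γ` on `X` is a homomorphism `Φ : Γ →* (X ≃ₜ X)` to the group of
homeomorphisms of `X` (with composition as multiplication). A Cantor space is a nonempty compact
metric space which is totally disconnected and has no isolated points. -/

section Actions

variable {Γ : Type*} [Group Γ] {X : Type*}

/-- Every orbit is dense. -/
def IsMinimal [TopologicalSpace X] (Φ : Γ →* (X ≃ₜ X)) : Prop :=
  ∀ x : X, Dense (Set.range fun g : Γ => Φ g x)

/-- Equicontinuity with respect to the metric of `X`. -/
def IsEquicontinuous [MetricSpace X] (Φ : Γ →* (X ≃ₜ X)) : Prop :=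
  ∀ ε : ℝ, 0 < ε → ∃ δ : ℝ, 0 < δ ∧
    ∀ (x y : X) (g : Γ), dist x y < δ → dist (Φ g x) (Φ g y) < ε

/-- An action is locally quasi-analytic if there is `ε > 0` such that two group elements which
agree on some nonempty open subset `V` of an open set `U` of diameter less than `ε` agree
on `U`. -/
def IsLocallyQuasiAnalytic [MetricSpace X] (Φ : Γ →* (X ≃ₜ X)) : Prop :=
  ∃ ε : ℝ, 0 < ε ∧ ∀ U : Set X, IsOpen U → U.Nonempty → Metric.diam U < ε →
    ∀ V : Set X, IsOpen V → V.Nonempty → V ⊆ U →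
      ∀ g₁ g₂ : Γ, Set.EqOn (Φ g₁) (Φ g₂) V → Set.EqOn (Φ g₁) (Φ g₂) U

/-- The closure of `Φ(Γ)` in `Homeo(X)`, in the topology of uniform convergence. -/
def profiniteClosure [MetricSpace X] [CompactSpace X] (Φ : Γ →* (X ≃ₜ X)) :
    Subgroup (X ≃ₜ X) where
  carrier := {h | ∀ ε : ℝ, 0 < ε → ∃ g : Γ, ∀ x : X, dist (Φ g x) (h x) < ε}
  one_mem' := fun ε hε => ⟨1, fun x => by simpa using hε⟩
  mul_mem' := by
    intro a b ha hb ε hε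
    obtain ⟨δ, hδ, hu⟩ := Metric.uniformContinuous_iff.1
      (CompactSpace.uniformContinuous_of_continuous a.continuous) (ε / 2) (half_pos hε)
    obtain ⟨g₁, h₁⟩ := ha (ε / 2) (half_pos hε)
    obtain ⟨g₂, h₂⟩ := hb δ hδ
    refine ⟨g₁ * g₂, fun x => ?_⟩
    rw [map_mul]
    calc dist (Φ g₁ (Φ g₂ x)) (a (b x))
        ≤ dist (Φ g₁ (Φ g₂ x)) (a (Φ g₂ x)) + dist (a (Φ g₂ x)) (a (b x)) :=
          dist_triangle _ _ _
      _ < ε / 2 + ε / 2 := add_lt_add (h₁ _) (hu (h₂ x))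
      _ = ε := add_halves ε
  inv_mem' := by
    intro a ha ε hε
    obtain ⟨δ, hδ, hu⟩ := Metric.uniformContinuous_iff.1
      (CompactSpace.uniformContinuous_of_continuous a.symm.continuous) ε hε
    obtain ⟨g, hg⟩ := ha δ hδ
    refine ⟨g⁻¹, fun y => ?_⟩
    have h1 := hu (hg ((Φ g).symm y))
    rw [map_inv, dist_comm]
    rw [a.symm_apply_apply, (Φ g).apply_symm_apply] at h1
    exact h1

/-- An action is stable if the action on `X` of the closure of `Φ(Γ)` in `Homeo(X)` is locally
quasi-analytic. -/
def IsStable [MetricSpace X] [CompactSpace X] (Φ : Γ →* (X ≃ₜ X)) : Prop :=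
  IsLocallyQuasiAnalytic (profiniteClosure Φ).subtype

/-- `U` is adapted to the action: it is nonempty and clopen, and each translate of `U` either
equals `U` or is disjoint from `U`. -/
def IsAdapted [TopologicalSpace X] (Φ : Γ →* (X ≃ₜ X)) (U : Set X) : Prop :=
  U.Nonempty ∧ IsClopen U ∧ ∀ g : Γ, (Φ g '' U ∩ U).Nonempty → Φ g '' U = U

/-- The subgroup `Γ_U` of return times `{g | g U ∩ U ≠ ∅}` of an adapted set `U`. -/
def returnSubgroup [TopologicalSpace X] (Φ : Γ →* (X ≃ₜ X)) (U : Set X)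
    (hU : IsAdapted Φ U) : Subgroup Γ where
  carrier := {g | (Φ g '' U ∩ U).Nonempty}
  one_mem' := by
    obtain ⟨x, hx⟩ := hU.1
    exact ⟨x, ⟨x, hx, by simp⟩, hx⟩
  mul_mem' := by
    intro a b ha hb
    obtain ⟨x, hx⟩ := hU.1
    have hb' : Φ b x ∈ U := hU.2.2 b hb ▸ Set.mem_image_of_mem (Φ b) hx
    have ha' : Φ a (Φ b x) ∈ U := hU.2.2 a ha ▸ Set.mem_image_of_mem (Φ a) hb'
    refine ⟨Φ a (Φ b x), ⟨x, hx, ?_⟩, ha'⟩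
    rw [map_mul]
    rfl
  inv_mem' := by
    rintro a ⟨y, ⟨x, hx, rfl⟩, hy⟩
    refine ⟨x, ⟨Φ a x, hy, ?_⟩, hx⟩
    rw [map_inv]
    exact (Φ a).symm_apply_apply x

/-- An adapted neighborhood basis at `x`: a properly descending chain of adapted sets with
intersection `{x}`. -/
structure IsAdaptedNeighborhoodBasis [TopologicalSpace X] (Φ : Γ →* (X ≃ₜ X)) (x : X)
    (U : ℕ → Set X) : Prop where
  adapted : ∀ n, IsAdapted Φ (U n)
  descending : ∀ n, U (n + 1) ⊂ U n
  iInter_eq : ⋂ n, U n = {x}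

end Actions

/-! ### Steinitz numbers -/

/-- A Steinitz number `∏ p ^ χ(p)`, given by its characteristic function `χ`. -/
abbrev SteinitzNumber : Type := Nat.Primes → ℕ∞

namespace SteinitzNumber

/-- The Steinitz number of a natural number (with `0` sent to `∏ p ^ ∞`). -/
noncomputable def ofNat (n : ℕ) : SteinitzNumber := fun p => emultiplicity (p : ℕ) n

/-- The product of two Steinitz numbers: exponents add. -/
def mul (ξ η : SteinitzNumber) : SteinitzNumber := fun p => ξ p + η p

/-- The least common multiple of a sequence of natural numbers: the exponents are the suprema. -/
noncomputable def lcm (a : ℕ → ℕ) : SteinitzNumber := fun p => ⨆ n, ofNat (a n) p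

/-- The primes which occur in `ξ` with nonzero exponent. -/
def primeSpectrum (ξ : SteinitzNumber) : Set Nat.Primes := {p | 0 < ξ p}

/-- Two Steinitz numbers are asymptotically equivalent if `m ξ = m' η` for some integers
`m, m' ≥ 1`; the equivalence class of `ξ` is its type. -/
def AsymptoticallyEquivalent (ξ η : SteinitzNumber) : Prop :=
  ∃ m m' : ℕ, 1 ≤ m ∧ 1 ≤ m' ∧ mul (ofNat m) ξ = mul (ofNat m') η

end SteinitzNumber

section Spectrum

variable {Γ : Type*} [Group Γ] {X : Type*} [TopologicalSpace X]

/-- The Steinitz order of the action as computed from an adapted neighborhood basis `U`: the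
least common multiple of the cardinalities of the finite sets `Γ / Γ_{U n}`. -/
noncomputable def steinitzOrder (Φ : Γ →* (X ≃ₜ X)) (x : X) (U : ℕ → Set X)
    (hU : IsAdaptedNeighborhoodBasis Φ x U) : SteinitzNumber :=
  SteinitzNumber.lcm fun n => (returnSubgroup Φ (U n) (hU.adapted n)).index

/-- The action has finite prime spectrum: some Steinitz number in the type of the action
involves only finitely many primes. The type is computed from some adapted neighborhood basis. -/
def HasFinitePrimeSpectrum (Φ : Γ →* (X ≃ₜ X)) : Prop :=
  ∃ (x : X) (U : ℕ → Set X) (hU : IsAdaptedNeighborhoodBasis Φ x U) (ξ : SteinitzNumber),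
    ξ.AsymptoticallyEquivalent (steinitzOrder Φ x U hU) ∧ ξ.primeSpectrum.Finite

end Spectrum

/-- `Γ` contains a finitely generated nilpotent subgroup of finite index. -/
def IsVirtuallyFGNilpotent (Γ : Type*) [Group Γ] : Prop :=
  ∃ H : Subgroup Γ, H.FiniteIndex ∧ Group.FG H ∧ Group.IsNilpotent H

end CantorAction

/-! The pointwise stabilizers in `profiniteClosure Φ` of a shrinking adapted basis `U n` form an
increasing chain, and stability follows once this chain stops growing
(`exists_pointwiseStabilizer_le`). Minimality moves any small open set back to the base point.

To stop the chain, let the closure act on the finite sets of classes of `visitSetoid Φ (U n)`, which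
jointly separate points. This gives a map to a profinite product in which the image of `Γ` is dense
in the image of the closure. The closure of the image of `Γ` satisfies the ascending chain condition
on closed subgroups. The condition passes through finite index and extensions, so a central series
reduces it to adding one topological generator `t`. There a closed subgroup is controlled by one set
of exponents per prime dividing the orders of `t`. Each set can only shrink along a chain, hence
stabilizes, and finitely many primes give a common bound (`closedACC_of_topologicallyCyclic`). With
infinitely many primes this fails, as in the product of all `ℤ/p`.

The primes are controlled because an element of a nilpotent group raised to the index of a subgroup
lies in that subgroup. -/

/-! ### Chain conditions for closed subgroups -/

namespace Subgroup

open scoped Pointwise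

variable {P : Type*} [Group P] [TopologicalSpace P]

/-- Every increasing sequence of closed subgroups contained in `A` and containing `B` is
eventually constant. -/
def ClosedACC (B A : Subgroup P) : Prop :=
  ∀ H : ℕ → Subgroup P, Monotone H → (∀ n, IsClosed (H n : Set P)) → (∀ n, B ≤ H n) →
    (∀ n, H n ≤ A) → ∃ L, ∀ n, L ≤ n → H n = H L

theorem closedACC_bot : ClosedACC (⊥ : Subgroup P) ⊥ :=
  fun _ _ _ _ hA => ⟨0, fun n _ => (le_bot_iff.1 (hA n)).trans (le_bot_iff.1 (hA 0)).symm⟩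

/-- The ascending chain condition on closed subgroups is inherited by extensions. -/
theorem ClosedACC.extension [IsTopologicalGroup P] [CompactSpace P] {A B : Subgroup P}
    (hBcl : IsClosed (B : Set P)) (hBA : B ≤ A)
    (hnorm : ∀ a ∈ A, ∀ b ∈ B, a * b * a⁻¹ ∈ B)
    (hB : ClosedACC ⊥ B) (hAB : ClosedACC B A) : ClosedACC ⊥ A := by
  intro H hmono hcl _ hA
  have hcoe : ∀ n, ((H n ⊔ B : Subgroup P) : Set P) = H n * B := fun n =>
    Subgroup.coe_mul_of_left_le_normalizer_right _ _
      (le_normalizer_iff.2 fun a ha b hb => hnorm a (hA n ha) b hb)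
  obtain ⟨L₁, h₁⟩ := hB (fun n => H n ⊓ B) (fun i j hij => inf_le_inf_right _ (hmono hij))
    (fun n => by rw [coe_inf]; exact (hcl n).inter hBcl) (fun _ => bot_le) (fun _ => inf_le_right)
  obtain ⟨L₂, h₂⟩ := hAB (fun n => H n ⊔ B) (fun i j hij => sup_le_sup_right (hmono hij) _)
    (fun n => by
      rw [hcoe]
      exact (hcl n).mul_right_of_isCompact hBcl.isCompact) (fun _ => le_sup_right)
    (fun n => sup_le (hA n) hBA)
  refine ⟨max L₁ L₂, fun n hn => le_antisymm (fun x hx => ?_) (hmono hn)⟩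
  -- Write `x = h * b` using stability of `H n * B`; then `b` lies in `H n ⊓ B`, which is stable
  -- too.
  have hx' : x ∈ ((H L₂ ⊔ B : Subgroup P) : Set P) := by
    have := h₂ n (le_trans (le_max_right _ _) hn)
    rw [SetLike.mem_coe, ← this]
    exact le_sup_left (a := H n) hx
  rw [hcoe] at hx'
  obtain ⟨h, hh, b, hb, rfl⟩ := hx'
  have hhL : h ∈ H (max L₁ L₂) := hmono (le_max_right _ _) hh
  have hbn : b ∈ H n ⊓ B :=
    ⟨by simpa using (H n).mul_mem ((H n).inv_mem (hmono hn hhL)) hx, hb⟩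
  have hbL : b ∈ H L₁ ⊓ B := by
    have := h₁ n (le_trans (le_max_left _ _) hn)
    rwa [this] at hbn
  exact (H _).mul_mem hhL (hmono (le_max_left _ _) hbL.1)

/-- The ascending chain condition on closed subgroups passes to subsets covered by finitely many
cosets. -/
theorem ClosedACC.of_subset_finite_mul {E A : Subgroup P} (hA : IsClosed (A : Set P))
    (hacc : ClosedACC ⊥ A) {T : Set P} (hT : T.Finite)
    (hE : (E : Set P) ⊆ T * (A : Set P)) : ClosedACC ⊥ E := by
  intro H hmono hcl _ hHE
  obtain ⟨L₁, h₁⟩ := hacc (fun n => H n ⊓ A) (fun i j hij => inf_le_inf_right _ (hmono hij))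
    (fun n => by rw [coe_inf]; exact (hcl n).inter hA) (fun _ => bot_le) (fun _ => inf_le_right)
  have : Finite T := hT
  -- The cosets `c * A` met by `H n` form an increasing chain of subsets of the finite set `T`.
  obtain ⟨L₂, h₂⟩ := WellFoundedGT.monotone_chain_condition
    (⟨fun n => {c : T | ∃ a ∈ A, (c : P) * a ∈ H n},
      fun i j hij c ⟨a, ha, hc⟩ => ⟨a, ha, hmono hij hc⟩⟩ : ℕ →o Set T)
  refine ⟨max L₁ L₂, fun n hn => le_antisymm (fun x hx => ?_) (hmono hn)⟩
  obtain ⟨c, hc, a, ha, rfl⟩ := hE (hHE n hx)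
  have hcn : (⟨c, hc⟩ : T) ∈ {c : T | ∃ a ∈ A, (c : P) * a ∈ H n} := ⟨a, ha, hx⟩
  have heq := h₂ n (le_trans (le_max_right _ _) hn)
  rw [show {c : T | ∃ a ∈ A, (c : P) * a ∈ H n} = {c : T | ∃ a ∈ A, (c : P) * a ∈ H L₂} from
    heq.symm] at hcn
  obtain ⟨a', ha', hca'⟩ := hcn
  have hcL : c * a' ∈ H (max L₁ L₂) := hmono (le_max_right _ _) hca'
  have hq : a'⁻¹ * a ∈ H n ⊓ A :=
    ⟨by simpa [mul_assoc] using (H n).mul_mem ((H n).inv_mem (hmono hn hcL)) hx,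
      A.mul_mem (A.inv_mem ha') ha⟩
  have heq₁ := h₁ n (le_trans (le_max_left _ _) hn)
  rw [heq₁] at hq
  simpa [mul_assoc] using (H _).mul_mem hcL (hmono (le_max_left _ _) hq.1)

end Subgroup

/-- A decreasing sequence of lower sets of natural numbers is eventually constant. -/
theorem antitone_lowerSet_nat_eventually_const {E : ℕ → Set ℕ} (hE : Antitone E)
    (hlow : ∀ n, IsLowerSet (E n)) : ∃ L, ∀ n, L ≤ n → E L ⊆ E n := by
  by_cases h : ∀ n a, a ∈ E n
  · exact ⟨0, fun n _ a _ => h n a⟩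
  push Not at h
  obtain ⟨n₀, a₀, h₀⟩ := h
  have hfin : ∀ n, n₀ ≤ n → (E n).Finite := fun n hn =>
    (Set.finite_Iio a₀).subset fun a ha => by
      by_contra hlt
      exact h₀ (hE hn (hlow n (not_lt.1 hlt) ha))
  -- From `n₀` on the sets are finite, so one of least cardinality equals all later ones.
  let L := Function.argmin (fun n => (E (n₀ + n)).ncard)
  refine ⟨n₀ + L, fun n hn => ?_⟩
  refine (Set.eq_of_subset_of_ncard_le (hE hn) ?_ (hfin _ (Nat.le_add_right _ _))).symm.subset
  have := Function.argmin_le (fun n => (E (n₀ + n)).ncard) (n - n₀)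
  rwa [Nat.add_sub_cancel' (by omega)] at this

/-! ### Adding one topological generator -/

namespace Subgroup

variable {P : Type*} [Group P] [TopologicalSpace P]

/-- The exponents `a` such that `p ^ a` divides the order of `t` modulo some open subgroup
containing `H`. -/
def primeExponents (t : P) (p : ℕ) (H : Subgroup P) : Set ℕ :=
  {a | ∃ M : OpenSubgroup P, H ≤ M ∧ ∀ k : ℤ, t ^ k ∈ M → ((p ^ a : ℕ) : ℤ) ∣ k}

theorem isLowerSet_primeExponents (t : P) (p : ℕ) (H : Subgroup P) :
    IsLowerSet (primeExponents t p H) := fun _ _ hba ⟨M, hM, h⟩ =>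
  ⟨M, hM, fun k hk => (Int.natCast_dvd_natCast.2 (pow_dvd_pow p hba)).trans (h k hk)⟩

theorem primeExponents_antitone (t : P) (p : ℕ) : Antitone (primeExponents t p) :=
  fun _ _ hle _ ⟨M, hM, h⟩ => ⟨M, hle.trans hM, h⟩

/-- Closed subgroups between `B` and a group topologically generated by `B` and one element `t`
satisfy the ascending chain condition, if the order of `t` involves finitely many primes. -/
theorem closedACC_of_topologicallyCyclic [IsTopologicalGroup P] [CompactSpace P]
    [TotallyDisconnectedSpace P] [T2Space P] {A B : Subgroup P} (t : P)
    (hgen : ∀ x ∈ A, ∀ W : OpenSubgroup P, ∃ b ∈ B, ∃ k : ℤ, (b * t ^ k)⁻¹ * x ∈ W)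
    (s : Finset ℕ)
    (hs : ∀ M : OpenSubgroup P, ∃ m : ℕ, m ≠ 0 ∧ m.primeFactors ⊆ s ∧ t ^ m ∈ M) :
    ClosedACC B A := by
  intro H hmono hcl hB hA
  choose L hL using fun p : ℕ => antitone_lowerSet_nat_eventually_const
    (fun i j hij => primeExponents_antitone t p (hmono hij))
    (fun n => isLowerSet_primeExponents t p (H n))
  refine ⟨s.sup L, fun n hn => le_antisymm ?_ (hmono hn)⟩
  have hinf := ProfiniteGrp.closedSubgroup_eq_sInf_open (⟨H (s.sup L), hcl _⟩ : ClosedSubgroup P)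
  change H (s.sup L) = _ at hinf
  rw [hinf]
  refine le_sInf ?_
  rintro M' ⟨hM, hle⟩
  let M : OpenSubgroup P := ⟨M', hM⟩
  -- The order of `t` modulo `M'`, which need not be normal: the period of the trivial coset.
  let k₀ := MulAction.period t ((1 : P) : P ⧸ M')
  have hk₀ : ∀ k : ℤ, t ^ k ∈ M' ↔ (k₀ : ℤ) ∣ k := by
    intro k
    rw [← MulAction.zpow_smul_eq_iff_period_dvd, eq_comm, MulAction.Quotient.smul_coe,
      QuotientGroup.eq]
    simp
  obtain ⟨m, hm0, hms, hmM⟩ := hs M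
  have hk₀m : k₀ ∣ m := Int.natCast_dvd_natCast.1 ((hk₀ m).1 (by rwa [zpow_natCast]))
  have hprimes : ∀ u ⊆ s, ∃ N : OpenSubgroup P, H n ≤ N ∧
      ∀ k : ℤ, t ^ k ∈ N → ∀ p ∈ u, ((p ^ k₀.factorization p : ℕ) : ℤ) ∣ k := by
    intro u
    induction u using Finset.induction with
    | empty => exact fun _ => ⟨⊤, le_top, fun _ _ _ hp => absurd hp (Finset.notMem_empty _)⟩
    | insert p u _ ih =>
      intro hu
      obtain ⟨N, hN, hNk⟩ := ih fun q hq => hu (Finset.mem_insert_of_mem hq)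
      have hp : p ∈ s := hu (Finset.mem_insert_self _ _)
      have hv : k₀.factorization p ∈ primeExponents t p (H (s.sup L)) :=
        ⟨M, hle, fun k hk => (Int.natCast_dvd_natCast.2 (Nat.ordProj_dvd k₀ p)).trans
          ((hk₀ k).1 hk)⟩
      have hLp : L p ≤ s.sup L := Finset.le_sup hp
      obtain ⟨N', hN', hNk'⟩ := hL p n (hLp.trans hn)
        (primeExponents_antitone t p (hmono hLp) hv)
      refine ⟨N ⊓ N', le_inf hN hN', fun k hk q hq => ?_⟩
      rcases Finset.mem_insert.1 hq with rfl | hq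
      · exact hNk' k hk.2
      · exact hNk k hk.1 q hq
  -- `N` contains `H n` and detects every prime power in `k₀`, so powers of `t` in `N` lie in `M'`.
  -- Approximating an element of `H n` by `b * t ^ k` modulo `N ⊓ M` then puts it in `M'`.
  obtain ⟨N, hN, hNk⟩ := hprimes s subset_rfl
  have hNM : ∀ k : ℤ, t ^ k ∈ N → t ^ k ∈ M' := by
    intro k hk
    rw [hk₀, Int.natCast_dvd, Nat.dvd_iff_prime_pow_dvd_dvd]
    intro p j hp hpj
    have hk0 : k₀ ≠ 0 := fun h => hm0 (zero_dvd_iff.1 (h ▸ hk₀m))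
    rcases Nat.eq_zero_or_pos j with rfl | hj
    · simp
    have hps : p ∈ s := hms (Nat.mem_primeFactors.2
      ⟨hp, ((dvd_pow_self p hj.ne').trans hpj).trans hk₀m, hm0⟩)
    exact (pow_dvd_pow p ((hp.pow_dvd_iff_le_factorization hk0).1 hpj)).trans
      (Int.natCast_dvd.1 (hNk k hk p hps))
  intro x hx
  obtain ⟨b, hb, k, hk⟩ := hgen x (hA n hx) (N ⊓ M)
  have hbx : b⁻¹ * x ∈ N := N.mul_mem (N.inv_mem (hN (hB n hb))) (hN hx)
  have htk : t ^ k ∈ N := by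
    have := N.mul_mem hbx (N.inv_mem hk.1)
    simpa [mul_assoc] using this
  have hbM : b ∈ M' := hle (hB _ hb)
  have := M'.mul_mem (M'.mul_mem hbM (hNM k htk)) hk.2
  simpa [mul_assoc] using this

end Subgroup

/-! ### Finitely generated nilpotent groups -/

namespace Subgroup

open scoped commutatorElement

variable {G : Type*} [Group G]

/-- In a nilpotent group, the power of an element with exponent the index of a subgroup lies in
that subgroup, normal or not. -/
theorem pow_index_mem_of_isNilpotent [Group.IsNilpotent G] (H : Subgroup G) (hH : H.index ≠ 0)
    (g : G) : g ^ H.index ∈ H := by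
  induction hn : H.index using Nat.strong_induction_on generalizing H with
  | _ n ih =>
    subst hn
    by_cases htop : H = ⊤
    · simp [htop]
    -- `H` is proper in its normalizer `N`, so induction applies to `N`, and `H` is normal in `N`.
    have hlt := Group.normalizerCondition_of_isNilpotent (G := G) H (lt_top_iff_ne_top.2 htop)
    set N := normalizer (H : Set G)
    have hmul : H.relIndex N * N.index = H.index := relIndex_mul_index hlt.le
    have hN0 : N.index ≠ 0 := fun h => hH (by rw [← hmul, h, mul_zero])
    have hrel : H.relIndex N ≠ 1 := fun h => hlt.not_ge (relIndex_eq_one.1 h)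
    have hrel0 : H.relIndex N ≠ 0 := fun h => hH (by rw [← hmul, h, zero_mul])
    have hNlt : N.index < H.index := by
      rw [← hmul]
      exact lt_mul_of_one_lt_left (Nat.pos_of_ne_zero hN0) (by omega)
    have hgN := ih _ hNlt N hN0 rfl
    have : (H.subgroupOf N).Normal := inferInstance
    have hpow := (H.subgroupOf N).pow_index_mem ⟨_, hgN⟩
    rw [mem_subgroupOf] at hpow
    rw [← hmul, mul_comm, pow_mul]
    exact hpow

open Nat in
/-- An exponent for the action of a nilpotent subgroup `D` of finite index on the cosets of `S`,
with no prime divisors other than those of the index of `S` and the primes up to the index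
of `D`. -/
theorem pow_factorial_mul_index_mem {D S : Subgroup G} [Group.IsNilpotent D] (hD : D.index ≠ 0)
    (hS : S.index ≠ 0) {g : G} (hg : g ∈ D) : g ^ (D.index ! * S.index) ∈ S := by
  have : D.FiniteIndex := ⟨hD⟩
  have : S.FiniteIndex := ⟨hS⟩
  have hle : D.relIndex S ≤ D.index := by
    simpa using relIndex_le_of_le_right (H := D) (le_top : S ≤ ⊤) (by simpa using hD)
  have hne : D.relIndex S ≠ 0 := FiniteIndex.index_ne_zero (H := D.subgroupOf S)
  -- `[D : D ∩ S] [G : D] = [S : D ∩ S] [G : S]`. As `D` may not be normal, `[S : D ∩ S]` is only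
  -- known to be at most `[G : D]`, hence the factorial.
  have hdvd : S.relIndex D ∣ D.index ! * S.index := by
    refine (Dvd.intro D.index ?_).trans (mul_dvd_mul_right
      (Nat.dvd_factorial (Nat.pos_of_ne_zero hne) hle) S.index)
    rw [← inf_relIndex_right, relIndex_mul_index inf_le_right, ← inf_relIndex_right D S,
      relIndex_mul_index inf_le_right, inf_comm]
  have hmem := (S.subgroupOf D).pow_index_mem_of_isNilpotent FiniteIndex.index_ne_zero ⟨g, hg⟩
  obtain ⟨c, hc⟩ := hdvd
  rw [hc, pow_mul]
  exact S.pow_mem hmem c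

/-- The successive quotients of the lower central series of a finitely generated group are
finitely generated. -/
theorem exists_finset_lowerCentralSeries_le [Group.FG G] (n : ℕ) :
    ∃ T : Finset G, (T : Set G) ⊆ lowerCentralSeries (⊤ : Subgroup G) n ∧
      lowerCentralSeries (⊤ : Subgroup G) n ≤
        closure (T : Set G) ⊔ lowerCentralSeries (⊤ : Subgroup G) (n + 1) := by
  classical
  obtain ⟨S, hS⟩ := Group.FG.out (G := G)
  induction n with
  | zero => exact ⟨S, fun _ _ => mem_top _, by rw [hS]; exact le_sup_of_le_left le_top⟩
  | succ n ih =>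
    obtain ⟨T, hT, hle⟩ := ih
    let γ := lowerCentralSeries (⊤ : Subgroup G)
    have hcomm : ∀ {k : ℕ} {a : G}, a ∈ γ k → ∀ g, ⁅a, g⁆ ∈ γ (k + 1) := fun ha g =>
      commutator_mem_commutator ha (mem_top g)
    let T' : Finset G := Finset.image₂ (fun t s => ⁅t, s⁆) T S
    have hT' : (T' : Set G) ⊆ γ (n + 1) := by
      intro x hx
      obtain ⟨t, ht, s, -, rfl⟩ := Finset.mem_image₂.1 hx
      exact hcomm (hT ht) s
    refine ⟨T', hT', ?_⟩
    set K : Subgroup G := closure (T' : Set G) ⊔ lowerCentralSeries (⊤ : Subgroup G) (n + 2)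
      with hK
    have hKle : K ≤ γ (n + 1) := sup_le ((closure_le _).2 hT')
      (lowerCentralSeries_antitone _ (Nat.le_succ _))
    have hγK : γ (n + 2) ≤ K := le_sup_right
    have hKn : K.Normal := ⟨fun x hx g => by
      have h1 : ⁅x, g⁆⁻¹ ∈ K := K.inv_mem (hγK (hcomm (hKle hx) g))
      have h2 := K.mul_mem h1 hx
      rwa [commutatorElement_inv, commutatorElement_def, inv_mul_cancel_right] at h2⟩
    have hmk : ∀ a g : G, Commute (a : G ⧸ K) g ↔ ⁅a, g⁆ ∈ K := by
      intro a g
      rw [← commutatorElement_eq_one_iff_commute, ← QuotientGroup.eq_one_iff]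
      rfl
    -- It suffices that `γ n` is central modulo `K`. For `T` this is checked against the generators
    -- `S` only, since a centralizer is a subgroup.
    let C : Subgroup G := (center (G ⧸ K)).comap (QuotientGroup.mk' K)
    have hC : ∀ a : G, a ∈ C ↔ ∀ g, ⁅a, g⁆ ∈ K := by
      intro a
      rw [mem_comap, mem_center_iff, QuotientGroup.forall_mk]
      exact forall_congr' fun g => by rw [← hmk]; exact eq_comm
    have hTC : (T : Set G) ⊆ C := by
      intro t ht
      refine (hC t).2 fun g => (hmk t g).1 ?_
      let Z : Subgroup G := (centralizer {(t : G ⧸ K)}).comap (QuotientGroup.mk' K)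
      have hSZ : closure (S : Set G) ≤ Z := (closure_le _).2 fun s hs =>
        mem_comap.2 (mem_centralizer_singleton_iff.2
          ((hmk t s).2 (le_sup_left (a := closure (T' : Set G))
            (subset_closure (Finset.mem_image₂_of_mem ht hs)))).symm)
      have hg : g ∈ Z := hSZ (hS ▸ mem_top g)
      exact (mem_centralizer_singleton_iff.1 (mem_comap.1 hg)).symm
    have hγC : γ n ≤ C := hle.trans (sup_le ((closure_le _).2 hTC) fun a ha =>
      (hC a).2 fun g => hγK (hcomm ha g))
    exact commutator_le.2 fun a ha g _ => (hC a).1 (hγC ha) g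

end Subgroup

/-! ### Topologically finitely generated nilpotent groups -/

namespace Subgroup

open scoped Pointwise commutatorElement

variable {P : Type*} [Group P] [TopologicalSpace P] [IsTopologicalGroup P]

theorem exists_inv_mul_mem_of_mem_topologicalClosure {S : Subgroup P} {x : P}
    (hx : x ∈ S.topologicalClosure) (W : OpenSubgroup P) : ∃ y ∈ S, y⁻¹ * x ∈ W := by
  have hopen : IsOpen {y : P | y⁻¹ * x ∈ W} :=
    W.isOpen.preimage (continuous_inv.mul continuous_const)
  obtain ⟨y, hy, hyS⟩ := mem_closure_iff.1 hx _ hopen (by simp)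
  exact ⟨y, hyS, hy⟩

theorem conj_mem_topologicalClosure {B A : Subgroup P}
    (h : ∀ a ∈ A, ∀ b ∈ B, a * b * a⁻¹ ∈ B) :
    ∀ a ∈ A.topologicalClosure, ∀ b ∈ B.topologicalClosure,
      a * b * a⁻¹ ∈ B.topologicalClosure := by
  have h1 : ∀ a ∈ A, ∀ b ∈ B.topologicalClosure, a * b * a⁻¹ ∈ B.topologicalClosure :=
    fun a ha b hb => map_mem_closure (f := fun b => a * b * a⁻¹) (by fun_prop) hb (h a ha)
  intro a ha b hb
  have := map_mem_closure (f := fun a => a * b * a⁻¹) (by fun_prop) ha (fun a ha => h1 a ha b hb)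
  rwa [B.isClosed_topologicalClosure.closure_eq] at this

/-- The ascending chain condition passes from the closure of the image of a subgroup of finite
index to the closure of the image of the whole group. -/
theorem ClosedACC.of_finiteIndex {G : Type*} [Group G] (ρ : G →* P)
    (D : Subgroup G) [D.FiniteIndex]
    (hD : ClosedACC ⊥ (D.map ρ).topologicalClosure) :
    ClosedACC ⊥ ρ.range.topologicalClosure := by
  let T : Set P := Set.range fun q : G ⧸ D => ρ q.out
  have hT : T.Finite := Set.finite_range _
  refine hD.of_subset_finite_mul (isClosed_topologicalClosure _) hT ?_
  have hcl : IsClosed (T * ((D.map ρ).topologicalClosure : Set P)) :=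
    (isClosed_topologicalClosure _).mul_left_of_isCompact hT.isCompact
  refine closure_minimal ?_ hcl
  rintro _ ⟨g, rfl⟩
  refine ⟨ρ (g : G ⧸ D).out, ⟨_, rfl⟩, ρ ((g : G ⧸ D).out⁻¹ * g),
    le_topologicalClosure _ ⟨_, ?_, rfl⟩, by simp⟩
  exact QuotientGroup.eq.1 (QuotientGroup.out_eq' _)

variable [CompactSpace P] [T2Space P] [TotallyDisconnectedSpace P] {G : Type*} [Group G]

/-- Since `C` is normal, every element of `C ⊔ zpowers t` is some `c * t ^ k`, so the one-generator
criterion applies on top of the closure of the image of `C`. -/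
theorem ClosedACC.sup_zpowers (ρ : G →* P) (s : Finset ℕ) (t : G)
    (hs : ∀ M : OpenSubgroup P, ∃ m : ℕ, m ≠ 0 ∧ m.primeFactors ⊆ s ∧ ρ t ^ m ∈ M)
    {C : Subgroup G} [C.Normal] (hC : ClosedACC ⊥ (C.map ρ).topologicalClosure) :
    ClosedACC ⊥ ((C ⊔ zpowers t).map ρ).topologicalClosure := by
  refine hC.extension (isClosed_topologicalClosure _)
    (topologicalClosure_mono (map_mono le_sup_left)) (conj_mem_topologicalClosure ?_)
    (closedACC_of_topologicallyCyclic (ρ t) ?_ s hs)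
  · rintro _ ⟨a, -, rfl⟩ _ ⟨b, hb, rfl⟩
    exact ⟨a * b * a⁻¹, Normal.conj_mem inferInstance b hb a, by simp⟩
  · intro x hx W
    obtain ⟨_, ⟨y, hy, rfl⟩, hyx⟩ := exists_inv_mul_mem_of_mem_topologicalClosure hx W
    obtain ⟨c, hc, _, ⟨k, rfl⟩, rfl⟩ := mem_sup_of_normal_left.1 hy
    exact ⟨ρ c, le_topologicalClosure _ ⟨c, hc, rfl⟩, k, by simpa using hyx⟩

/-- A compact totally disconnected group which is topologically generated by the image of a
finitely generated nilpotent group, and whose order involves only finitely many primes, satisfies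
the ascending chain condition on closed subgroups. -/
theorem closedACC_topologicalClosure_range [Group.FG G] [Group.IsNilpotent G] (ρ : G →* P)
    (s : Finset ℕ) (hs : ∀ (g : G) (M : OpenSubgroup P),
      ∃ m : ℕ, m ≠ 0 ∧ m.primeFactors ⊆ s ∧ ρ g ^ m ∈ M) :
    ClosedACC ⊥ ρ.range.topologicalClosure := by
  classical
  let γ := lowerCentralSeries (⊤ : Subgroup G)
  have hγanti : Antitone γ := lowerCentralSeries_antitone _
  have hcomm : ∀ {k : ℕ} {a : G}, a ∈ γ k → ∀ g, ⁅g, a⁆ ∈ γ (k + 1) := fun ha g => by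
    rw [← commutatorElement_inv]
    exact inv_mem (commutator_mem_commutator ha (mem_top g))
  -- Centrality of `γ n / γ (n + 1)` lets generators be added one at a time through normal
  -- subgroups.
  have hnormal : ∀ (n : ℕ) (C : Subgroup G), γ (n + 1) ≤ C → C ≤ γ n → C.Normal :=
    fun n C h1 h2 => ⟨fun x hx g => by
      have := C.mul_mem (h1 (hcomm (h2 hx) g)) hx
      rwa [commutatorElement_def, inv_mul_cancel_right] at this⟩
  have hstep : ∀ n, ClosedACC ⊥ ((γ (n + 1)).map ρ).topologicalClosure →
      ClosedACC ⊥ ((γ n).map ρ).topologicalClosure := by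
    intro n hn
    obtain ⟨T, hT, hle⟩ := exists_finset_lowerCentralSeries_le (G := G) n
    have key : ∀ U : Finset G, (U : Set G) ⊆ γ n →
        ClosedACC ⊥ ((γ (n + 1) ⊔ closure (U : Set G)).map ρ).topologicalClosure := by
      intro U
      induction U using Finset.induction with
      | empty => intro _; simpa using hn
      | insert t U _ ih =>
        intro hU
        rw [Finset.coe_insert, Set.insert_subset_iff] at hU
        have hnor := hnormal n (γ (n + 1) ⊔ closure (U : Set G)) le_sup_left
          (sup_le (hγanti (Nat.le_succ n)) ((closure_le _).2 hU.2))
        have := (ih hU.2).sup_zpowers ρ s t (hs t)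
        rwa [sup_assoc, zpowers_eq_closure, ← closure_union, Set.union_singleton,
          ← Finset.coe_insert] at this
    have heq : γ (n + 1) ⊔ closure (T : Set G) = γ n :=
      le_antisymm (sup_le (hγanti (Nat.le_succ n)) ((closure_le _).2 hT)) (by rwa [sup_comm])
    simpa only [heq] using key T hT
  obtain ⟨c, hc⟩ := nilpotent_iff_lowerCentralSeries.1 ‹Group.IsNilpotent G›
  have hall : ∀ j ≤ c, ClosedACC ⊥ ((γ (c - j)).map ρ).topologicalClosure := by
    intro j
    induction j with
    | zero =>
      intro _
      have h0 : (((γ (c - 0)).map ρ).topologicalClosure : Subgroup P) = ⊥ := by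
        rw [Nat.sub_zero, show γ c = ⊥ from hc, map_bot]
        exact SetLike.coe_injective (by simp [topologicalClosure_coe])
      rw [h0]
      exact closedACC_bot
    | succ j ih =>
      intro hj
      refine hstep _ ?_
      rw [show c - (j + 1) + 1 = c - j by omega]
      exact ih (by omega)
  have := hall c le_rfl
  rwa [Nat.sub_self, show γ 0 = ⊤ from rfl, ← MonoidHom.range_eq_map] at this

/-- A chain condition for subgroups of a product of finite groups which are approximated by the
image of a virtually nilpotent group. -/
theorem exists_forall_approx_of_monotone {ι : Type*} {Q : ι → Type*} [∀ i, Group (Q i)]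
    [∀ i, Finite (Q i)] {G : Type*} [Group G] (ρ : G →* ∀ i, Q i) (D : Subgroup G)
    [D.FiniteIndex] [Group.FG D] [Group.IsNilpotent D] (s : Finset ℕ)
    (hs : ∀ i, ∃ m : ℕ, m ≠ 0 ∧ m.primeFactors ⊆ s ∧ ∀ g ∈ D, ρ g i ^ m = 1)
    {K : ℕ → Subgroup (∀ i, Q i)} (hK : Monotone K)
    (happrox : ∀ n, ∀ k ∈ K n, ∀ F : Finset ι, ∃ g : G, ∀ i ∈ F, ρ g i = k i) :
    ∃ L, ∀ n, L ≤ n → ∀ k ∈ K n, ∀ i, ∃ k' ∈ K L, k' i = k i := by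
  let _ : ∀ i, TopologicalSpace (Q i) := fun _ => ⊥
  have : ∀ i, DiscreteTopology (Q i) := fun _ => ⟨rfl⟩
  choose m hm0 hms hm using hs
  have hD : ClosedACC ⊥ (D.map ρ).topologicalClosure := by
    rw [← MonoidHom.domRestrict_range]
    refine closedACC_topologicalClosure_range _ s fun g M => ?_
    obtain ⟨F, u, hu, hFM⟩ := isOpen_pi_iff.1 M.isOpen 1 M.one_mem
    -- Membership in `M` is guaranteed by the finitely many coordinates in `F`, so the product of
    -- their exponents works.
    refine ⟨∏ i ∈ F, m i, Finset.prod_ne_zero_iff.2 fun i _ => hm0 i, fun p hp => ?_,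
      hFM fun i hi => ?_⟩
    · obtain ⟨hp, hdvd, -⟩ := Nat.mem_primeFactors.1 hp
      obtain ⟨i, -, hi⟩ := (hp.prime.dvd_finsetProd_iff _).1 hdvd
      exact hms i (Nat.mem_primeFactors.2 ⟨hp, hi, hm0 i⟩)
    · obtain ⟨c, hc⟩ := Finset.dvd_prod_of_mem m hi
      have h1 : ρ g i ^ (∏ i ∈ F, m i) = 1 := by rw [hc, pow_mul, hm i g g.2, one_pow]
      have h2 := (hu i hi).2
      rwa [Pi.one_apply, ← h1] at h2
  have hcl : ∀ n, (K n).topologicalClosure ≤ ρ.range.topologicalClosure := fun n =>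
    topologicalClosure_minimal _ (fun k hk => mem_closure_iff.2 fun o ho hko => by
      obtain ⟨F, u, hu, hFo⟩ := isOpen_pi_iff.1 ho k hko
      obtain ⟨g, hg⟩ := happrox n k hk F
      exact ⟨ρ g, hFo fun i hi => by rw [hg i hi]; exact (hu i hi).2, g, rfl⟩)
      (isClosed_topologicalClosure _)
  obtain ⟨L, hL⟩ := hD.of_finiteIndex ρ D (fun n => (K n).topologicalClosure)
    (fun i j hij => topologicalClosure_mono (hK hij)) (fun n => isClosed_topologicalClosure _)
    (fun _ => bot_le) hcl
  refine ⟨L, fun n hn k hk i => ?_⟩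
  -- The `K n` need not be closed, so only the closures stabilize; hence `k'` may depend on `i`.
  have hkL : k ∈ (K L).topologicalClosure := hL n hn ▸ le_topologicalClosure _ hk
  obtain ⟨k', hk', hk'L⟩ := mem_closure_iff.1 hkL {x | x i = k i}
    ((isOpen_discrete {k i}).preimage (continuous_apply i)) rfl
  exact ⟨k', hk'L, hk'⟩

end Subgroup

/-! ### Stability -/

namespace CantorAction

variable {Γ : Type*} [Group Γ] {X : Type*}

/-- Two points are identified if their orbits visit `U` at the same times. -/
def visitSetoid [TopologicalSpace X] (Φ : Γ →* (X ≃ₜ X)) (U : Set X) : Setoid X where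
  r y z := ∀ g : Γ, Φ g y ∈ U ↔ Φ g z ∈ U
  iseqv := ⟨fun _ _ => Iff.rfl, fun h g => (h g).symm, fun h₁ h₂ g => (h₁ g).trans (h₂ g)⟩

theorem visitSetoid_map [TopologicalSpace X] (Φ : Γ →* (X ≃ₜ X)) (U : Set X) {y z : X}
    (h : visitSetoid Φ U y z) (g : Γ) : visitSetoid Φ U (Φ g y) (Φ g z) := fun g' => by
  have := h (g' * g)
  rwa [map_mul] at this

/-- The normal core of the return subgroup acts trivially on classes, because `c g y = (c g c⁻¹) (c
y)`. -/
theorem visitSetoid_of_conj_mem [TopologicalSpace X] {Φ : Γ →* (X ≃ₜ X)} {U : Set X}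
    (hU : IsAdapted Φ U) {g : Γ} (hg : ∀ c : Γ, c * g * c⁻¹ ∈ returnSubgroup Φ U hU) (y : X) :
    visitSetoid Φ U (Φ g y) y := by
  have key : ∀ h ∈ returnSubgroup Φ U hU, ∀ z ∈ U, Φ h z ∈ U := fun h hh z hz =>
    hU.2.2 h hh ▸ Set.mem_image_of_mem (Φ h) hz
  have happ : ∀ (a b : Γ) (z : X), Φ a (Φ b z) = Φ (a * b) z := fun a b z => by
    rw [map_mul]; rfl
  intro c
  constructor
  · intro h
    have := key _ ((returnSubgroup Φ U hU).inv_mem (hg c)) _ h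
    rwa [happ, happ, mul_assoc, show (c * g * c⁻¹)⁻¹ * (c * g) = c by group] at this
  · intro h
    have := key _ (hg c) _ h
    rwa [happ, inv_mul_cancel_right, ← happ] at this

/-- The finitely many primes of an action with finite prime spectrum divide all indices of
return subgroups. -/
theorem exists_finset_primeFactors_index_subset [TopologicalSpace X] {Φ : Γ →* (X ≃ₜ X)} {x : X}
    {U : ℕ → Set X} (hU : IsAdaptedNeighborhoodBasis Φ x U) {ξ : SteinitzNumber}
    (hξ : ξ.AsymptoticallyEquivalent (steinitzOrder Φ x U hU)) (hfin : ξ.primeSpectrum.Finite) :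
    ∃ s : Finset ℕ, ∀ n, (returnSubgroup Φ (U n) (hU.adapted n)).index ≠ 0 ∧
      (returnSubgroup Φ (U n) (hU.adapted n)).index.primeFactors ⊆ s := by
  obtain ⟨m, m', hm, -, heq⟩ := hξ
  let s : Finset ℕ := m.primeFactors ∪ hfin.toFinset.image (fun p : Nat.Primes => (p : ℕ))
  have hs : ∀ n (p : ℕ), p.Prime → p ∣ (returnSubgroup Φ (U n) (hU.adapted n)).index → p ∈ s := by
    intro n p hp hdvd
    have h1 : (steinitzOrder Φ x U hU) ⟨p, hp⟩ ≠ 0 := by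
      have h2 : emultiplicity p (returnSubgroup Φ (U n) (hU.adapted n)).index ≤
          steinitzOrder Φ x U hU ⟨p, hp⟩ :=
        le_iSup (fun n => emultiplicity p (returnSubgroup Φ (U n) (hU.adapted n)).index) n
      exact fun h => emultiplicity_ne_zero.2 hdvd (le_zero_iff.1 (h ▸ h2))
    have h2 : emultiplicity p m + ξ ⟨p, hp⟩ ≠ 0 := by
      have := congrFun heq ⟨p, hp⟩
      simp only [SteinitzNumber.mul, SteinitzNumber.ofNat] at this
      rw [this]
      exact fun h => h1 (add_eq_zero.1 h).2
    by_cases hpm : p ∣ m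
    · exact Finset.mem_union_left _ (Nat.mem_primeFactors.2 ⟨hp, hpm, by omega⟩)
    · rw [emultiplicity_eq_zero.2 hpm, zero_add] at h2
      exact Finset.mem_union_right _ (Finset.mem_image.2
        ⟨⟨p, hp⟩, hfin.mem_toFinset.2 (pos_iff_ne_zero.2 h2), rfl⟩)
  refine ⟨s, fun n => ⟨fun h0 => ?_, fun p hp => ?_⟩⟩
  -- An infinite index is recorded as `0`, which every prime divides, contradicting finiteness of
  -- `s`.
  · obtain ⟨p, hp, hps⟩ := Nat.infinite_setOfPred_prime.exists_notMem_finset s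
    exact hps (hs n p hp (h0 ▸ dvd_zero p))
  · exact hs n p (Nat.prime_of_mem_primeFactors hp) (Nat.dvd_of_mem_primeFactors hp)

/-! ### Finite permutation quotients of the closure -/

variable [MetricSpace X] [CompactSpace X] {Φ : Γ →* (X ≃ₜ X)}

/-- Some thickening of the compact open set `U` stays in `U`; equicontinuity makes the scale uniform
in `g`. -/
theorem exists_visitSetoid_of_dist_lt (hequi : IsEquicontinuous Φ) {U : Set X} (hU : IsClopen U) :
    ∃ δ : ℝ, 0 < δ ∧ ∀ y z : X, dist y z < δ → visitSetoid Φ U y z := by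
  obtain ⟨ε, hε, hsub⟩ := hU.isClosed.isCompact.exists_thickening_subset_open hU.isOpen subset_rfl
  obtain ⟨δ, hδ, h⟩ := hequi ε hε
  have key : ∀ a b : X, dist a b < ε → a ∈ U → b ∈ U := fun a b hab ha =>
    hsub (Metric.mem_thickening_iff.2 ⟨a, ha, by rwa [dist_comm]⟩)
  exact ⟨δ, hδ, fun y z hyz g =>
    ⟨key _ _ (h y z g hyz), key _ _ (by rw [dist_comm]; exact h y z g hyz)⟩⟩

theorem finite_quotient_visitSetoid (hequi : IsEquicontinuous Φ) {U : Set X} (hU : IsClopen U) :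
    Finite (Quotient (visitSetoid Φ U)) := by
  obtain ⟨δ, hδ, h⟩ := exists_visitSetoid_of_dist_lt hequi hU
  obtain ⟨t, -, htfin, ht⟩ := finite_cover_balls_of_compact (isCompact_univ (X := X)) hδ
  have : Finite t := htfin
  refine Finite.of_surjective (fun y : t => (⟦(y : X)⟧ : Quotient (visitSetoid Φ U))) ?_
  refine Quotient.ind fun z => ?_
  obtain ⟨y, hy, hz⟩ := Set.mem_iUnion₂.1 (ht (Set.mem_univ z))
  exact ⟨⟨y, hy⟩, Quotient.sound (h y z (by rwa [dist_comm]))⟩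

/-- This is the density of the image of `Γ` in that of the closure, inside the product of
permutation groups. -/
theorem exists_forall_visitSetoid (hequi : IsEquicontinuous Φ) {U : ℕ → Set X}
    (hU : ∀ n, IsClopen (U n)) (h : profiniteClosure Φ) (F : Finset ℕ) :
    ∃ g : Γ, ∀ n ∈ F, ∀ x, visitSetoid Φ (U n) (Φ g x) (h.1 x) := by
  choose δ hδ hvisit using fun n => exists_visitSetoid_of_dist_lt hequi (hU n)
  obtain ⟨ε, hε, hεδ⟩ : ∃ ε : ℝ, 0 < ε ∧ ∀ n ∈ F, ε ≤ δ n := by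
    rcases F.eq_empty_or_nonempty with rfl | hF
    · exact ⟨1, one_pos, by simp⟩
    · obtain ⟨n, -, hn⟩ := F.exists_min_image δ hF
      exact ⟨δ n, hδ n, hn⟩
  obtain ⟨g, hg⟩ := h.2 ε hε
  exact ⟨g, fun n hn x => hvisit n _ _ ((hg x).trans_le (hεδ n hn))⟩

theorem visitSetoid_map_profiniteClosure (hequi : IsEquicontinuous Φ) {U : Set X}
    (hU : IsClopen U) (h : profiniteClosure Φ) {y z : X} (hyz : visitSetoid Φ U y z) :
    visitSetoid Φ U (h.1 y) (h.1 z) := by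
  obtain ⟨g, hg⟩ := exists_forall_visitSetoid hequi (fun _ => hU) h {0}
  have hg := hg 0 (Finset.mem_singleton_self 0)
  exact Setoid.trans' _ (Setoid.symm' _ (hg y))
    (Setoid.trans' _ (visitSetoid_map Φ U hyz g) (hg z))

/-- The closure of the action permutes the classes of points visiting `U` at the same times. -/
def visitPerm (hequi : IsEquicontinuous Φ) {U : Set X} (hU : IsClopen U) :
    profiniteClosure Φ →* Equiv.Perm (Quotient (visitSetoid Φ U)) :=
  MonoidHom.toHomPerm
    { toFun := fun h => Quotient.map h.1 fun _ _ => visitSetoid_map_profiniteClosure hequi hU h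
      map_one' := funext <| Quotient.ind fun _ => rfl
      map_mul' := fun _ _ => funext <| Quotient.ind fun _ => rfl }

theorem mem_profiniteClosure (Φ : Γ →* (X ≃ₜ X)) (g : Γ) : Φ g ∈ profiniteClosure Φ :=
  fun ε hε => ⟨g, fun x => by simpa using hε⟩

theorem IsAdaptedNeighborhoodBasis.exists_subset {x : X} {U : ℕ → Set X}
    (hU : IsAdaptedNeighborhoodBasis Φ x U) {V : Set X} (hV : IsOpen V) (hx : x ∈ V) :
    ∃ N, ∀ n, N ≤ n → U n ⊆ V := by
  have hanti : Antitone U := antitone_nat_of_succ_le fun n => (hU.descending n).subset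
  obtain ⟨N, hN⟩ := exists_subset_nhds_of_compactSpace hanti.directed_ge
    (fun n => (hU.adapted n).2.1.isClosed) (U := V) (fun y hy => by
      rw [hU.iInter_eq, Set.mem_singleton_iff] at hy
      exact hy ▸ hV.mem_nhds hx)
  exact ⟨N, fun n hn => (hanti hn).trans hN⟩

/-- Minimality moves `y` into a tiny `U N`, and `z` follows. Equicontinuity, applied to `g⁻¹`, then
makes `y` and `z` closer than their distance. -/
theorem IsAdaptedNeighborhoodBasis.eq_of_forall_visitSetoid (hmin : IsMinimal Φ)
    (hequi : IsEquicontinuous Φ) {x : X} {U : ℕ → Set X}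
    (hU : IsAdaptedNeighborhoodBasis Φ x U) {y z : X} (h : ∀ n, visitSetoid Φ (U n) y z) :
    y = z := by
  by_contra hne
  obtain ⟨δ, hδ, hδe⟩ := hequi (dist y z) (dist_pos.2 hne)
  obtain ⟨N, hN⟩ := hU.exists_subset Metric.isOpen_ball (Metric.mem_ball_self (half_pos hδ))
  obtain ⟨_, ⟨g, rfl⟩, hg⟩ := (hmin y).exists_mem_open (hU.adapted N).2.1.isOpen (hU.adapted N).1
  have hz := (h N g).1 hg
  have hdist : dist (Φ g y) (Φ g z) < δ := by
    have h1 := Metric.mem_ball.1 (hN N le_rfl hg)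
    have h2 := Metric.mem_ball'.1 (hN N le_rfl hz)
    linarith [dist_triangle (Φ g y) x (Φ g z)]
  have := hδe _ _ g⁻¹ hdist
  rw [map_inv] at this
  change dist ((Φ g).symm (Φ g y)) ((Φ g).symm (Φ g z)) < dist y z at this
  rw [Homeomorph.symm_apply_apply, Homeomorph.symm_apply_apply] at this
  exact lt_irrefl _ this

/-- The elements of the closure of the action which fix `U` pointwise. -/
def pointwiseStabilizer (Φ : Γ →* (X ≃ₜ X)) (U : Set X) : Subgroup (profiniteClosure Φ) where
  carrier := {h | ∀ x ∈ U, h.1 x = x}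
  one_mem' := fun _ _ => rfl
  mul_mem' := fun {a _} ha hb x hx => (congrArg a.1 (hb x hx)).trans (ha x hx)
  inv_mem' := fun {a} ha x hx => (congrArg a.1.symm (ha x hx)).symm.trans (a.1.symm_apply_apply x)

theorem exists_pointwiseStabilizer_le (hnil : IsVirtuallyFGNilpotent Γ) (hmin : IsMinimal Φ)
    (hequi : IsEquicontinuous Φ) {x : X} {U : ℕ → Set X} (hU : IsAdaptedNeighborhoodBasis Φ x U)
    {ξ : SteinitzNumber} (hξ : ξ.AsymptoticallyEquivalent (steinitzOrder Φ x U hU))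
    (hfin : ξ.primeSpectrum.Finite) :
    ∃ L, ∀ n, L ≤ n → pointwiseStabilizer Φ (U n) ≤ pointwiseStabilizer Φ (U L) := by
  obtain ⟨D, hD, _, _⟩ := hnil
  obtain ⟨s, hs⟩ := exists_finset_primeFactors_index_subset hU hξ hfin
  have hcl : ∀ n, IsClopen (U n) := fun n => (hU.adapted n).2.1
  have : ∀ n, Finite (Quotient (visitSetoid Φ (U n))) := fun n =>
    finite_quotient_visitSetoid hequi (hcl n)
  have hanti : Antitone U := antitone_nat_of_succ_le fun n => (hU.descending n).subset
  let f : profiniteClosure Φ →* ∀ n, Equiv.Perm (Quotient (visitSetoid Φ (U n))) :=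
    MonoidHom.pi fun n => visitPerm hequi (hcl n)
  let ρ := f.comp (Φ.codRestrict (profiniteClosure Φ) (mem_profiniteClosure Φ))
  obtain ⟨L, hL⟩ := Subgroup.exists_forall_approx_of_monotone ρ D
    ((D.index.factorial).primeFactors ∪ s) (fun n => by
      obtain ⟨hne, hsub⟩ := hs n
      refine ⟨D.index.factorial * (returnSubgroup Φ (U n) (hU.adapted n)).index,
        mul_ne_zero (Nat.factorial_ne_zero _) hne, ?_, fun g hg => ?_⟩
      · rw [Nat.primeFactors_mul (Nat.factorial_ne_zero _) hne]
        exact Finset.union_subset_union_right hsub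
      · rw [← Pi.pow_apply, ← map_pow]
        refine Equiv.ext (Quotient.ind fun y => Quotient.sound
          -- All conjugates of the return subgroup have the same index, so one exponent puts `g`
          -- into each of them.
          (visitSetoid_of_conj_mem (hU.adapted n) (fun c => ?_) y))
        have hidx := Subgroup.index_comap_of_surjective
          (returnSubgroup Φ (U n) (hU.adapted n)) (f := (MulAut.conj c).toMonoidHom)
          (MulAut.conj c).surjective
        have := Subgroup.pow_factorial_mul_index_mem hD.index_ne_zero (by rwa [hidx]) hg
        rw [hidx] at this
        exact this)
    (K := fun n => (pointwiseStabilizer Φ (U n)).map f)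
    (fun i j hij => Subgroup.map_mono fun h hh y hy => hh y (hanti hij hy))
    (by
      rintro n _ ⟨h, -, rfl⟩ F
      obtain ⟨g, hg⟩ := exists_forall_visitSetoid hequi hcl h F
      exact ⟨g, fun i hi => Equiv.ext (Quotient.ind fun y => Quotient.sound (hg i hi y))⟩)
  refine ⟨L, fun n hn h hh y hy => hU.eq_of_forall_visitSetoid hmin hequi fun i => ?_⟩
  -- At each level `i`, `h` acts like some `k` fixing `U L`, so `h y` and `y` share a class at every
  -- level.
  obtain ⟨_, ⟨k, hk, rfl⟩, hki⟩ := hL n hn (f h) ⟨h, hh, rfl⟩ i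
  have := Quotient.exact (Equiv.congr_fun hki ⟦y⟧)
  change visitSetoid Φ (U i) (k.1 y) (h.1 y) at this
  rw [hk y hy] at this
  exact Setoid.symm' _ this

end CantorAction

theorem theorem1p1 {Γ : Type*} [Group Γ] {X : Type*} [MetricSpace X] [CompactSpace X]
    [TotallyDisconnectedSpace X] [PerfectSpace X] [Nonempty X] (Φ : Γ →* (X ≃ₜ X))
    (hnil : CantorAction.IsVirtuallyFGNilpotent Γ)
    (hmin : CantorAction.IsMinimal Φ) (hequi : CantorAction.IsEquicontinuous Φ)
    (hspec : CantorAction.HasFinitePrimeSpectrum Φ) :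
    CantorAction.IsStable Φ := by
  obtain ⟨x, U, hU, ξ, hξ, hfin⟩ := hspec
  obtain ⟨L, hL⟩ := CantorAction.exists_pointwiseStabilizer_le hnil hmin hequi hU hξ hfin
  obtain ⟨ε, hε, hvisit⟩ := CantorAction.exists_visitSetoid_of_dist_lt hequi (hU.adapted L).2.1
  have hxL : x ∈ U L := Set.mem_iInter.1 (hU.iInter_eq ▸ Set.mem_singleton x) L
  refine ⟨ε, hε, fun O _ _ hdiam V hV hVne hVO g₁ g₂ heq u hu => ?_⟩
  obtain ⟨_, ⟨g, rfl⟩, hg⟩ := (hmin x).exists_mem_open hV hVne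
  obtain ⟨N, hN⟩ := hU.exists_subset (hV.preimage (Φ g).continuous) hg
  let c : CantorAction.profiniteClosure Φ := ⟨Φ g, CantorAction.mem_profiniteClosure Φ g⟩
  -- Conjugation by `g` moves the agreement on `V` to a basic set at `x`; by the choice of `L` it
  -- spreads to `U L`.
  have hmem : c⁻¹ * (g₂⁻¹ * g₁) * c ∈ CantorAction.pointwiseStabilizer Φ (U (max L N)) := by
    intro y hy
    have h1 : g₁.1 (Φ g y) = g₂.1 (Φ g y) := heq (hN _ (le_max_right _ _) hy)
    change (Φ g).symm (g₂.1.symm (g₁.1 (Φ g y))) = y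
    rw [h1, Homeomorph.symm_apply_apply, Homeomorph.symm_apply_apply]
  have hdist : dist (Φ g x) u < ε :=
    (Metric.dist_le_diam_of_mem (Metric.isBounded_of_compactSpace) (hVO hg) hu).trans_lt hdiam
  -- Points within `ε` visit `U L` at the same times, so `g⁻¹` carries `u` into `U L` together with
  -- `g x`.
  have huL : (Φ g).symm u ∈ U L := by
    have := (hvisit _ _ hdist g⁻¹).1 (by
      rw [map_inv]
      exact ((Φ g).symm_apply_apply x).symm ▸ hxL)
    rwa [map_inv] at this
  have hfix : (Φ g).symm (g₂.1.symm (g₁.1 (Φ g ((Φ g).symm u)))) = (Φ g).symm u :=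
    hL _ (le_max_left _ _) hmem _ huL
  rw [Homeomorph.apply_symm_apply] at hfix
  have := (Φ g).symm.injective hfix
  exact g₂.1.symm_apply_eq.1 this
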